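/- Setting. Let $\Theta$ be a finite set of states, $A$ a nonempty set of actions, $T\subset\mathbb R_+$ a nonempty compact set of times, $\mu_0\in\Delta(\Theta)$ a prior, and $u,v:\Theta\times A\times T\to\mathbb R$ bounded. For $\mu\in\Delta(\Theta)$ and $t\in T$ let $U(\mu,t)=\max_{a\in A,\,s\in T,\,s\ge t}\sum_\theta u(\theta,a,s)\mu(\theta)$, and let $V(\mu,t)$ be the maximum of $\sum_\theta v(\theta,a,s)\mu(\theta)$ over the pairs $(a,s)$ that attain $U(\mu,t)$; $V$ is assumed measurable. A feasible strategy is a pair $(\langle\mu_t\rangle_{t\in T},\tau)$ on some filtered probability space, where $\langle\mu_t\rangle$ is an (almost surely) cadlag martingale in $\Delta(\Theta)$ with $\mathbb E[\mu_t]=\mu_0$ and $\tau$ is a $T$-valued stopping time. It is obedient if $\mathbb E[U(\mu_{\tau'},\tau')]\le\mathbb E[U(\mu_\tau,\tau)]$ for every $T$-valued stopping time $\tau'$. Let $\Delta_{\mu_0}$ be the set of probability measures $f$ on $\Delta(\Theta)\times T$ with $\mathbb E_f[\mu]=\mu_0$. Say that $f$ satisfies the pooled obedience constraint if for every $t\in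 T$ with $f(\tau>t)>0$, $$\mathbb E_f[U(\mu,\tau)\mid\tau>t]\ \ge\ U\big(\mathbb E_f[\mu\mid\tau>t],\,t\big).$$ For $f\in\Delta_{\mu_0}$ the simple recommendation strategy $(\langle\mu^f_t\rangle,\tau^f)$ is defined on the space of pairs $(\mu,t)$ with law $f$ by $\tau^f(\mu,t)=t$, $\mu^f_s(\mu,t)=\widehat\mu_s:=\mathbb E_f[\mu\mid\tau>s]$ for $s<t$, and $\mu^f_s(\mu,t)=\mu$ for $s\ge t$. Its filtration at time $t$ is generated by $\mu^f_s$ and $\mathbf 1\{\tau^f\le s\}$ for $s\le t$. Statement. (i) For every feasible and obedient strategy $(\langle\mu_t\rangle,\tau)$, the law $f$ of $(\mu_\tau,\tau)$ belongs to $\Delta_{\mu_0}$ and satisfies the pooled obedience constraint. (ii) Conversely, for every $f\in\Delta_{\mu_0}$ that satisfies the pooled obedience constraint, the simple recommendation strategy $(\langle\mu^f_t\rangle,\tau^f)$ is feasible and obedient, and $(\mu^f_{\tau^f},\tau^f)$ has law $f$. (iii) Consequently the problem (P) of maximizing $\mathbb E[V(\mu_\tau,\tau)]$ over feasible and obedient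 strategies is equivalent to the reduced problem (R) of maximizing $\int V\,df$ over $f\in\Delta_{\mu_0}$ subject to $$\int_{y>t}U(\mu,y)\,f(d\mu,dy)\ \ge\ U\Big(\int_{y>t}\mu\,f(d\mu,dy),\,t\Big)\qquad\text{for all } t\in T\setminus\{\sup T\},$$ where $U(\cdot,t)$ is extended to nonnegative vectors homogeneously of degree one. That is: for $f\in\Delta_{\mu_0}$ this constraint is equivalent to the pooled obedience constraint; the two problems have the same finite supremum; a feasible and obedient strategy solves (P) if and only if the law of $(\mu_\tau,\tau)$ solves (R); and $f\in\Delta_{\mu_0}$ solves (R) if and only if its simple recommendation strategy solves (P). -/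

import Mathlib

open MeasureTheory Filter Topology

universe uState uAction uProb

noncomputable section

/-- Beliefs: the simplex of probability vectors on the finite set `Θ` of states. -/
abbrev Belief (Θ : Type uState) [Fintype Θ] : Type uState := stdSimplex ℝ Θ

section Utilities

variable {Θ : Type uState} [Fintype Θ] {A : Type uAction} {T : Set ℝ}

/-- The expected payoff `∑ θ, w(θ, a, s) m(θ)` of action `a` taken at time `s`. -/
def expectedPayoff (w : Θ → A → T → ℝ) (m : Θ → ℝ) (a : A) (s : T) : ℝ :=
  ∑ θ, w θ a s * m θ

/-- The agent's indirect utility `U(m, t)` from stopping at time `t` with belief `m`: the best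
expected payoff over actions `a` and action times `s ≥ t`. -/
def agentUtility (u : Θ → A → T → ℝ) (m : Θ → ℝ) (t : T) : ℝ :=
  ⨆ q : A × {s : T // t ≤ s}, expectedPayoff u m q.1 q.2.1

/-- The agent's optimal pairs (action, action time `≥ t`) at belief `m`. -/
def agentOptimal (u : Θ → A → T → ℝ) (m : Θ → ℝ) (t : T) : Set (A × T) :=
  {p | t ≤ p.2 ∧ ∀ a s, t ≤ s → expectedPayoff u m a s ≤ expectedPayoff u m p.1 p.2}

/-- The principal's indirect utility `V(m, t)`: her best expected payoff among the agent's
optimal choices (ties are broken in her favour). -/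
def principalUtility (u v : Θ → A → T → ℝ) (m : Θ → ℝ) (t : T) : ℝ :=
  sSup ((fun p : A × T => expectedPayoff v m p.1 p.2) '' agentOptimal u m t)

/-- The extension of `U(·, t)` from the simplex to nonnegative vectors, homogeneous of
degree one: `(∑ θ, m θ) * U (m / ∑ θ, m θ, t)`. -/
def agentUtilityExt (u : Θ → A → T → ℝ) (m : Θ → ℝ) (t : T) : ℝ :=
  (∑ θ, m θ) * agentUtility u ((∑ θ, m θ)⁻¹ • m) t

end Utilities

section Strategies

variable {Θ : Type uState} [Fintype Θ] {A : Type uAction} {T : Set ℝ}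

/-- A path on the time space `T` is cadlag: right-continuous with left limits (limits are taken
within `T`). -/
def IsCadlagPath (x : T → Belief Θ) : Prop :=
  ∀ t : T, Tendsto x (𝓝[>] t) (𝓝 (x t)) ∧ ∃ l : Belief Θ, Tendsto x (𝓝[<] t) (𝓝 l)

/-- `(μ, τ)` is a feasible strategy on the filtered probability space `(Ω, ℱ, P)`: the belief
process is an almost surely cadlag martingale in the simplex whose mean is the prior (it may
already jump at the initial time), and `τ` is a `T`-valued stopping time. -/
structure IsFeasible (prior : Belief Θ) {Ω : Type uProb} {mΩ : MeasurableSpace Ω}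
    (P : Measure Ω) (ℱ : Filtration T mΩ) (μ : T → Ω → Belief Θ) (τ : Ω → T) : Prop where
  martingale : Martingale (fun t ω => (μ t ω : Θ → ℝ)) ℱ P
  cadlag : ∀ᵐ ω ∂P, IsCadlagPath fun t => μ t ω
  mean : ∀ t, ∫ ω, (μ t ω : Θ → ℝ) ∂P = prior
  stopping : IsStoppingTime ℱ fun ω => (τ ω : WithTop T)

/-- The obedience constraint: `τ` maximizes `E[U(μ_τ', τ')]` over all stopping times `τ'`. -/
def IsObedient (u : Θ → A → T → ℝ) {Ω : Type uProb} {mΩ : MeasurableSpace Ω}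
    (P : Measure Ω) (ℱ : Filtration T mΩ) (μ : T → Ω → Belief Θ) (τ : Ω → T) : Prop :=
  ∀ τ' : Ω → T, IsStoppingTime ℱ (fun ω => (τ' ω : WithTop T)) →
    ∫ ω, agentUtility u (μ (τ' ω) ω) (τ' ω) ∂P ≤ ∫ ω, agentUtility u (μ (τ ω) ω) (τ ω) ∂P

/-- The joint law of the stopping belief and the stopping time, `(μ_τ, τ)`. -/
def outcomeLaw {Ω : Type uProb} [MeasurableSpace Ω] (P : Measure Ω) (μ : T → Ω → Belief Θ)
    (τ : Ω → T) : Measure (Belief Θ × T) :=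
  P.map fun ω => (μ (τ ω) ω, τ ω)

/-- The principal's expected payoff `E[V(μ_τ, τ)]`. -/
def principalPayoff (u v : Θ → A → T → ℝ) {Ω : Type uProb} [MeasurableSpace Ω] (P : Measure Ω)
    (μ : T → Ω → Belief Θ) (τ : Ω → T) : ℝ :=
  ∫ ω, principalUtility u v (μ (τ ω) ω) (τ ω) ∂P

/-- The values that the principal attains in problem (P), over all filtered probability spaces,
belief martingales and obedient stopping times. -/
def valuesP (u v : Θ → A → T → ℝ) (prior : Belief Θ) : Set ℝ :=
  {r | ∃ (Ω : Type uState) (mΩ : MeasurableSpace Ω) (P : Measure Ω) (ℱ : Filtration T mΩ)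
      (μ : T → Ω → Belief Θ) (τ : Ω → T), IsProbabilityMeasure P ∧
      IsFeasible prior P ℱ μ τ ∧ IsObedient u P ℱ μ τ ∧ r = principalPayoff u v P μ τ}

/-- The strategy `(μ, τ)` solves problem (P). -/
def SolvesP (u v : Θ → A → T → ℝ) (prior : Belief Θ) {Ω : Type uProb} {mΩ : MeasurableSpace Ω}
    (P : Measure Ω) (ℱ : Filtration T mΩ) (μ : T → Ω → Belief Θ) (τ : Ω → T) : Prop :=
  IsFeasible prior P ℱ μ τ ∧ IsObedient u P ℱ μ τ ∧
    ∀ r ∈ valuesP u v prior, r ≤ principalPayoff u v P μ τ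

end Strategies

section Outcomes

variable {Θ : Type uState} [Fintype Θ] {A : Type uAction} {T : Set ℝ}

/-- `f` is a belief-time distribution consistent with the prior: a probability measure on
beliefs and times with `E_f[μ] = prior`. -/
structure IsConsistent (prior : Belief Θ) (f : Measure (Belief Θ × T)) : Prop where
  prob : IsProbabilityMeasure f
  mean : ∫ p, (p.1 : Θ → ℝ) ∂f = prior

/-- The event that stopping occurs strictly after `t`. -/
def stopsAfter (Θ : Type uState) [Fintype Θ] (t : T) : Set (Belief Θ × T) := {p | t < p.2}

/-- The conditional expectation `E_f[μ | τ > t]` of the stopping belief; meaningful when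
`f(τ > t) > 0`. -/
def pooledBelief (f : Measure (Belief Θ × T)) (t : T) : Θ → ℝ :=
  ⨍ p in stopsAfter Θ t, (p.1 : Θ → ℝ) ∂f

/-- The pooled obedience constraint: `E_f[U(μ, τ) | τ > t] ≥ U(E_f[μ | τ > t], t)` at every
time `t` after which stopping occurs with positive probability. -/
def PooledObedience (u : Θ → A → T → ℝ) (f : Measure (Belief Θ × T)) : Prop :=
  ∀ t : T, 0 < f (stopsAfter Θ t) →
    agentUtility u (pooledBelief f t) t ≤ ⨍ p in stopsAfter Θ t, agentUtility u p.1 p.2 ∂f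

/-- The unnormalized form of the constraint in the reduced problem: for all `t` in `T` other
than `sup T`, `∫_{y > t} U(μ, y) f(dμ, dy) ≥ U(∫_{y > t} μ f(dμ, dy), t)`, with the degree-one
homogeneous extension of `U` on the right. -/
def ReducedObedience (u : Θ → A → T → ℝ) (f : Measure (Belief Θ × T)) : Prop :=
  ∀ t : T, (t : ℝ) ≠ sSup T →
    agentUtilityExt u (∫ p in stopsAfter Θ t, (p.1 : Θ → ℝ) ∂f) t ≤
      ∫ p in stopsAfter Θ t, agentUtility u p.1 p.2 ∂f

/-- The objective `∫ V(μ, t) f(dμ, dt)` of the reduced problem (R). -/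
def reducedPayoff (u v : Θ → A → T → ℝ) (f : Measure (Belief Θ × T)) : ℝ :=
  ∫ p, principalUtility u v p.1 p.2 ∂f

/-- The values attained in the reduced problem (R). -/
def valuesR (u v : Θ → A → T → ℝ) (prior : Belief Θ) : Set ℝ :=
  {r | ∃ f : Measure (Belief Θ × T), IsConsistent prior f ∧ ReducedObedience u f ∧
    r = reducedPayoff u v f}

/-- The belief-time distribution `f` solves the reduced problem (R). -/
def SolvesR (u v : Θ → A → T → ℝ) (prior : Belief Θ) (f : Measure (Belief Θ × T)) : Prop :=
  IsConsistent prior f ∧ ReducedObedience u f ∧ ∀ r ∈ valuesR u v prior, r ≤ reducedPayoff u v f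

end Outcomes

section SimpleRecommendation

variable {Θ : Type uState} [Fintype Θ] {T : Set ℝ}

theorem pooledBelief_mem (f : Measure (Belief Θ × T)) [IsProbabilityMeasure f] (t : T)
    (h : 0 < f (stopsAfter Θ t)) : pooledBelief f t ∈ stdSimplex ℝ Θ := by
  have hm : Measurable fun p : Belief Θ × T => (p.1 : Θ → ℝ) :=
    measurable_subtype_coe.comp measurable_fst
  refine Convex.set_average_mem (convex_stdSimplex ℝ Θ) (isClosed_stdSimplex ℝ Θ) h.ne'
    (measure_ne_top _ _) (ae_of_all _ fun p => p.1.2) ?_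
  refine Integrable.integrableOn (Integrable.of_bound hm.aestronglyMeasurable 1
    (ae_of_all _ fun p => ?_))
  refine (pi_norm_le_iff_of_nonneg zero_le_one).2 fun θ => ?_
  have h0 : 0 ≤ p.1 θ := p.1.2.1 θ
  have h1 : ∑ i, p.1 i = 1 := p.1.2.2
  rw [Real.norm_eq_abs, abs_of_nonneg h0, ← h1]
  exact Finset.single_le_sum (f := fun i => p.1 i) (fun i _ => p.1.2.1 i) (Finset.mem_univ θ)

open scoped Classical in
/-- The continuation belief `E_f[μ | τ > t]` for those `t` after which stopping occurs with
positive probability. For other `t`, which no recommended path uses except on an `f`-null set,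
it is set to the prior. -/
def continuationBelief (prior : Belief Θ) (f : Measure (Belief Θ × T)) [IsProbabilityMeasure f]
    (t : T) : Belief Θ :=
  if h : 0 < f (stopsAfter Θ t) then ⟨pooledBelief f t, pooledBelief_mem f t h⟩ else prior

open scoped Classical in
/-- The belief process of the simple recommendation, on the space of pairs `p = (μ, t)` with
law `f`: at time `s` it is the continuation belief if `s < t`, and `μ` if `s ≥ t`. -/
def simpleBelief (prior : Belief Θ) (f : Measure (Belief Θ × T)) [IsProbabilityMeasure f]
    (s : T) (p : Belief Θ × T) : Belief Θ :=
  if s < p.2 then continuationBelief prior f s else p.1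

/-- The recommended stopping time `τ^f(μ, t) = t`. -/
def simpleTime (p : Belief Θ × T) : T := p.2

/-- The information of the agent under the simple recommendation at time `t`: the beliefs and the
recommendations (to stop or to continue) at all times `s ≤ t`. -/
def simpleFiltration (prior : Belief Θ) (f : Measure (Belief Θ × T)) [IsProbabilityMeasure f] :
    Filtration T (inferInstance : MeasurableSpace (Belief Θ × T)) where
  seq t := ⨆ s, ⨆ _ : s ≤ t, MeasurableSpace.comap
    (fun p => (simpleBelief prior f s p, (simpleTime p ≤ s : Prop))) inferInstance
  mono' _ _ hij := biSup_mono fun _ => ge_trans hij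
  le' t := by
    refine iSup₂_le fun s _ => Measurable.comap_le ?_
    have hs : MeasurableSet {p : Belief Θ × T | s < p.2} :=
      measurableSet_lt measurable_const measurable_snd
    have hs' : MeasurableSet {p : Belief Θ × T | p.2 ≤ s} :=
      measurableSet_le measurable_snd measurable_const
    exact (Measurable.ite hs measurable_const measurable_fst).prodMk
      (measurableSet_setOfPred.1 hs')

end SimpleRecommendation

end

/-!
Both directions rest on two properties of the agent's indirect utility `U(·, t)`: it is convex, as
a supremum of linear functionals (`convexOn_agentUtility`), and it decreases in `t`, since later
stopping leaves fewer action times (`agentUtility_antitone`). Together they also make `U` jointly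
measurable without any regularity of `u` in actions and times.

*From strategies to outcomes.* In a feasible and obedient strategy, consider the deviation
`min τ t`. It is unprofitable, so `E[U(μ_t, t); τ > t] ≤ E[U(μ_τ, τ); τ > t]`. As `{τ > t}` is known
at time `t`, optional stopping says that `μ_t` and `μ_τ` have the same mean on it, and Jensen's
inequality bounds `E[U(μ_t, t) | τ > t]` below by `U(E[μ_τ | τ > t], t)`. This is the pooled
obedience constraint (`IsObedient.pooledObedience_outcomeLaw`). The optional stopping theorem for
right-continuous martingales on a compact time set (`MeasureTheory.Martingale.optional_stopping`)
follows from the one for countably many times by discretizing the stopping time from above.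

*From outcomes to strategies.* In the simple recommendation of `f`, the information of the agent
before being told to stop is trivial (`mem_of_measurableSet_simpleFiltration`). Hence the beliefs
form a martingale, cadlag because `f(τ > t)` and `∫_{τ > t} μ df` are, and because `f(τ ≥ y) > 0`
for almost every realized time `y`. Hence also every stopping time either waits for the
recommendation to stop, or else stops at one deterministic time `s` on the whole of `{τ > s}`
(`eq_of_lt_of_isStoppingTime`). Late stopping does not pay because `U` decreases in time; early
stopping at `s` does not pay by the pooled constraint at `s` (`isObedient_simpleBelief`).

*Equivalence of the problems.* The outcome law determines the principal's payoff, so the two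
directions give the same set of attained values (`valuesP_eq_valuesR`). It is nonempty,
since the agent may be told to stop at once without information, and bounded.
-/

/-! ### The indirect utilities -/

section Utilities

variable {Θ : Type uState} [Fintype Θ] {A : Type uAction} {T : Set ℝ}

lemma abs_expectedPayoff_le {w : Θ → A → T → ℝ} {C : ℝ} (hw : ∀ θ a t, |w θ a t| ≤ C)
    {m : Θ → ℝ} (hm : m ∈ stdSimplex ℝ Θ) (a : A) (s : T) : |expectedPayoff w m a s| ≤ C := by
  calc |expectedPayoff w m a s| ≤ ∑ θ, |w θ a s * m θ| := Finset.abs_sum_le_sum_abs _ _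
    _ ≤ ∑ θ, C * m θ := by
        refine Finset.sum_le_sum fun θ _ => ?_
        rw [abs_mul, abs_of_nonneg (hm.1 θ)]
        exact mul_le_mul_of_nonneg_right (hw θ a s) (hm.1 θ)
    _ = C := by rw [← Finset.mul_sum, hm.2, mul_one]

lemma bddAbove_range_expectedPayoff {u : Θ → A → T → ℝ} (hu : ∃ C : ℝ, ∀ θ a t, |u θ a t| ≤ C)
    (m : Θ → ℝ) (t : T) :
    BddAbove (Set.range fun q : A × {s : T // t ≤ s} => expectedPayoff u m q.1 q.2.1) := by
  obtain ⟨C, hC⟩ := hu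
  refine ⟨∑ θ, C * |m θ|, ?_⟩
  rintro _ ⟨q, rfl⟩
  refine Finset.sum_le_sum fun θ _ => (le_abs_self _).trans ?_
  rw [abs_mul]
  exact mul_le_mul_of_nonneg_right (hC _ _ _) (abs_nonneg _)

lemma expectedPayoff_le_agentUtility {u : Θ → A → T → ℝ}
    (hu : ∃ C : ℝ, ∀ θ a t, |u θ a t| ≤ C) (m : Θ → ℝ) {t s : T} (hts : t ≤ s) (a : A) :
    expectedPayoff u m a s ≤ agentUtility u m t :=
  le_ciSup (bddAbove_range_expectedPayoff hu m t) (a, ⟨s, hts⟩)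

lemma agentUtility_le [Nonempty A] {u : Θ → A → T → ℝ} {m : Θ → ℝ} {t : T} {b : ℝ}
    (h : ∀ a s, t ≤ s → expectedPayoff u m a s ≤ b) : agentUtility u m t ≤ b :=
  haveI : Nonempty (A × {s : T // t ≤ s}) := ⟨(Classical.arbitrary A, ⟨t, le_rfl⟩)⟩
  ciSup_le fun q => h q.1 q.2.1 q.2.2

lemma abs_agentUtility_le [Nonempty A] {u : Θ → A → T → ℝ} {C : ℝ}
    (hu : ∀ θ a t, |u θ a t| ≤ C) {m : Θ → ℝ} (hm : m ∈ stdSimplex ℝ Θ) (t : T) :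
    |agentUtility u m t| ≤ C := by
  refine abs_le.2 ⟨?_, agentUtility_le fun a s _ =>
    (le_abs_self _).trans (abs_expectedPayoff_le hu hm a s)⟩
  exact (neg_le_of_abs_le (abs_expectedPayoff_le hu hm (Classical.arbitrary A) t)).trans
    (expectedPayoff_le_agentUtility ⟨C, hu⟩ m le_rfl _)

/-- The later the agent stops, the fewer action times remain available. -/
lemma agentUtility_antitone [Nonempty A] {u : Θ → A → T → ℝ}
    (hu : ∃ C : ℝ, ∀ θ a t, |u θ a t| ≤ C) (m : Θ → ℝ) : Antitone (agentUtility u m) :=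
  fun _ _ h => agentUtility_le fun a _ hs =>
    expectedPayoff_le_agentUtility hu m (h.trans hs) a

/-- `U(·, t)` is a supremum of linear functionals. -/
lemma convexOn_agentUtility [Nonempty A] {u : Θ → A → T → ℝ}
    (hu : ∃ C : ℝ, ∀ θ a t, |u θ a t| ≤ C) (t : T) :
    ConvexOn ℝ Set.univ fun m => agentUtility u m t := by
  refine ⟨convex_univ, fun x _ y _ a b ha hb _ => agentUtility_le fun c s hs => ?_⟩
  have h : expectedPayoff u (a • x + b • y) c s
      = a * expectedPayoff u x c s + b * expectedPayoff u y c s := by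
    simp only [expectedPayoff, Finset.mul_sum, ← Finset.sum_add_distrib, Pi.add_apply,
      Pi.smul_apply, smul_eq_mul]
    exact Finset.sum_congr rfl fun θ _ => by ring
  rw [h]
  exact add_le_add
    (mul_le_mul_of_nonneg_left (expectedPayoff_le_agentUtility hu x hs c) ha)
    (mul_le_mul_of_nonneg_left (expectedPayoff_le_agentUtility hu y hs c) hb)

lemma continuous_agentUtility [Nonempty A] {u : Θ → A → T → ℝ}
    (hu : ∃ C : ℝ, ∀ θ a t, |u θ a t| ≤ C) (t : T) :
    Continuous fun m : Θ → ℝ => agentUtility u m t :=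
  continuousOn_univ.1 ((convexOn_agentUtility hu t).continuousOn isOpen_univ)

/-- `U` is jointly measurable, being continuous in the belief and monotone in time; no regularity
of `u` in the action or in time is needed. -/
lemma measurable_agentUtility [Nonempty A] {u : Θ → A → T → ℝ}
    (hu : ∃ C : ℝ, ∀ θ a t, |u θ a t| ≤ C) :
    Measurable fun p : Belief Θ × T => agentUtility u p.1 p.2 :=
  (measurable_uncurry_of_continuous_of_measurable (continuous_agentUtility hu)
    fun m => (agentUtility_antitone hu m).measurable).comp
    ((measurable_subtype_coe.comp measurable_fst).prodMk measurable_snd)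

lemma abs_principalUtility_le {u v : Θ → A → T → ℝ} {C : ℝ} (hC : 0 ≤ C)
    (hv : ∀ θ a t, |v θ a t| ≤ C) {m : Θ → ℝ} (hm : m ∈ stdSimplex ℝ Θ) (t : T) :
    |principalUtility u v m t| ≤ C := by
  unfold principalUtility
  rcases Set.eq_empty_or_nonempty (agentOptimal u m t) with h | ⟨p, hp⟩
  · simpa [h] using hC
  have hb : ∀ x ∈ (fun p : A × T => expectedPayoff v m p.1 p.2) '' agentOptimal u m t,
      |x| ≤ C := by
    rintro _ ⟨q, -, rfl⟩
    exact abs_expectedPayoff_le hv hm _ _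
  refine abs_le.2 ⟨?_, csSup_le ⟨_, p, hp, rfl⟩ fun x hx => (le_abs_self _).trans (hb x hx)⟩
  exact (neg_le_of_abs_le (hb _ ⟨p, hp, rfl⟩)).trans
    (le_csSup ⟨C, fun x hx => (le_abs_self _).trans (hb x hx)⟩ ⟨p, hp, rfl⟩)

lemma norm_belief_le (m : Belief Θ) : ‖(m : Θ → ℝ)‖ ≤ 1 := by
  refine (pi_norm_le_iff_of_nonneg zero_le_one).2 fun θ => ?_
  rw [Real.norm_eq_abs]
  refine (abs_of_nonneg (m.2.1 θ)).le.trans ?_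
  exact (Finset.single_le_sum (fun i _ => m.2.1 i) (Finset.mem_univ θ)).trans m.2.2.le

end Utilities

/-! ### Stopping a right-continuous martingale on a compact time set -/

section OptionalStopping

variable {T : Set ℝ}

/-- On a compact set of reals the subspace topology is the order topology: it is finer than the
order topology, which is Hausdorff. -/
lemma IsCompact.orderTopology_subtype (hT : IsCompact T) : OrderTopology T := by
  have : CompactSpace T := isCompact_iff_compactSpace.1 hT
  have ho : ∀ a : T, IsOpen (Set.Ioi a) ∧ IsOpen (Set.Iio a) := fun a => ⟨isOpen_Ioi, isOpen_Iio⟩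
  refine ⟨?_⟩
  set t₁ : TopologicalSpace T := instTopologicalSpaceSubtype
  let t₂ : TopologicalSpace T := Preorder.topology T
  have : @OrderTopology T t₂ _ := @OrderTopology.mk T t₂ _ rfl
  have h12 : t₁ ≤ t₂ := by
    refine le_generateFrom ?_
    rintro s ⟨a, rfl | rfl⟩
    exacts [(ho a).1, (ho a).2]
  refine le_antisymm h12 ?_
  have h2 : @T2Space T t₂ := inferInstance
  have hcl : @IsClosedMap T T t₁ t₂ id :=
    @Continuous.isClosedMap T T t₁ t₂ _ h2 _ (continuous_id_of_le h12)
  refine fun s hs => (@isClosed_compl_iff T t₂ s).1 ?_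
  simpa using hcl _ ((@isClosed_compl_iff T t₁ s).2 hs)

/-- Every point of a compact set of reals is approximated from above, within the set, by points
of a countable subset. -/
lemma IsCompact.exists_discretization (hT : IsCompact T) (hTne : T.Nonempty) :
    ∃ d : ℕ → T → T, (∀ n, Measurable (d n)) ∧ (∀ n, (Set.range (d n)).Countable) ∧
      (∀ n x, x ≤ d n x) ∧ ∀ x, Tendsto (fun n => d n x) atTop (𝓝 x) := by
  -- `y c` is the largest point of `T` below `c`
  have key : ∀ c : ℝ, ∃ y : T, ∀ x : T, (x : ℝ) ≤ c → x ≤ y ∧ (y : ℝ) ≤ c := by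
    intro c
    rcases (T ∩ Set.Iic c).eq_empty_or_nonempty with h | h
    · exact ⟨⟨_, hTne.some_mem⟩, fun x hx =>
        absurd (h ▸ ⟨x.2, hx⟩ : (x : ℝ) ∈ (∅ : Set ℝ)) (by simp)⟩
    · obtain ⟨y, hy, hy'⟩ := (hT.inter_right isClosed_Iic).exists_isGreatest h
      exact ⟨⟨y, hy.1⟩, fun x hx => ⟨hy' ⟨x.2, hx⟩, hy.2⟩⟩
  choose y hy using key
  have hpos : ∀ n : ℕ, (0 : ℝ) < n + 1 := fun n => by positivity
  have hle : ∀ (n : ℕ) (x : T), (x : ℝ) ≤ (⌈(x : ℝ) * (n + 1)⌉ : ℤ) / (n + 1 : ℝ) := fun n x =>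
    (le_div_iff₀ (hpos n)).2 (Int.le_ceil _)
  refine ⟨fun n x => y ((⌈(x : ℝ) * (n + 1)⌉ : ℤ) / (n + 1 : ℝ)), fun n => ?_, fun n => ?_,
    fun n x => (hy _ x (hle n x)).1, fun x => ?_⟩
  · exact (measurable_from_top (f := fun k : ℤ => y (k / (n + 1 : ℝ)))).comp
      (Int.measurable_ceil.comp (measurable_subtype_coe.mul_const _))
  · refine (Set.countable_range fun k : ℤ => y (k / (n + 1 : ℝ))).mono ?_
    rintro _ ⟨x, rfl⟩
    exact ⟨_, rfl⟩
  · rw [tendsto_subtype_rng]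
    refine tendsto_of_tendsto_of_tendsto_of_le_of_le tendsto_const_nhds
      (h := fun n : ℕ => (x : ℝ) + 1 / ((n : ℝ) + 1)) ?_ (fun n => (hy _ x (hle n x)).1)
      fun n => (hy _ x (hle n x)).2.trans ?_
    · simpa using (tendsto_const_nhds (x := (x : ℝ))).add tendsto_one_div_add_atTop_nhds_zero_nat
    · have := (Int.ceil_lt_add_one ((x : ℝ) * (n + 1))).le
      rw [div_le_iff₀ (hpos n), add_mul, one_div_mul_cancel (hpos n).ne']
      exact this

variable {Ω : Type uProb} {mΩ : MeasurableSpace Ω} {ℱ : Filtration T mΩ} {τ : Ω → T}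

/-- An event about the value of a stopping time that forces this value to be at most `s` is known
at time `s`. -/
lemma measurableSet_preimage_of_isStoppingTime (hT : IsCompact T)
    (hτ : IsStoppingTime ℱ fun ω => (τ ω : WithTop T)) {s : T} {B : Set T} (hB : MeasurableSet B)
    (hBs : ∀ x ∈ B, x ≤ s) : MeasurableSet[ℱ s] (τ ⁻¹' B) := by
  have hle : ∀ x : T, MeasurableSet[ℱ x] {ω | τ ω ≤ x} := fun x => by
    simpa using hτ x
  have hmin : Measurable[ℱ s] fun ω => min (τ ω : ℝ) s := by
    refine measurable_of_Iic fun c => ?_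
    rcases le_or_gt (s : ℝ) c with hc | hc
    · convert @MeasurableSet.univ _ (ℱ s)
      ext ω
      simp [hc]
    rcases (T ∩ Set.Iic c).eq_empty_or_nonempty with h | h
    · convert @MeasurableSet.empty _ (ℱ s)
      ext ω
      have : ¬ (τ ω : ℝ) ≤ c := fun h' => (h ▸ ⟨(τ ω).2, h'⟩ : (τ ω : ℝ) ∈ (∅ : Set ℝ))
      simpa [hc.not_ge] using this
    · obtain ⟨y, hy, hy'⟩ := (hT.inter_right isClosed_Iic).exists_isGreatest h
      have hys : (⟨y, hy.1⟩ : T) ≤ s := (hy.2.trans_lt hc).le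
      convert ℱ.mono hys _ (hle ⟨y, hy.1⟩)
      ext ω
      simp only [Set.mem_preimage, Set.mem_Iic, inf_le_iff, hc.not_ge, or_false,
        Set.mem_ofPred_eq]
      exact ⟨fun h' => hy' ⟨(τ ω).2, h'⟩, fun h' => le_trans h' hy.2⟩
  obtain ⟨B', hB', rfl⟩ := hB
  convert (hle s).inter (hmin hB') using 1
  ext ω
  simp only [Set.mem_preimage, Set.mem_inter_iff, Set.mem_ofPred_eq]
  constructor
  · intro h
    have h' : (τ ω : ℝ) ≤ s := hBs _ h
    exact ⟨h', by rwa [min_eq_left h']⟩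
  · rintro ⟨h, h'⟩
    rwa [min_eq_left (show (τ ω : ℝ) ≤ s from h)] at h'

lemma measurable_of_isStoppingTime (hT : IsCompact T)
    (hτ : IsStoppingTime ℱ fun ω => (τ ω : WithTop T)) : Measurable τ := by
  rcases T.eq_empty_or_nonempty with rfl | hTne
  · exact fun s _ => by
      have : IsEmpty Ω := ⟨fun ω => (τ ω).2⟩
      rw [Set.eq_empty_of_isEmpty (τ ⁻¹' s)]
      exact MeasurableSet.empty
  obtain ⟨M, hM, hM'⟩ := hT.exists_isGreatest hTne
  exact fun B hB => ℱ.le ⟨M, hM⟩ _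
    (measurableSet_preimage_of_isStoppingTime hT hτ hB fun x _ => hM' x.2)

variable {E : Type*} [NormedAddCommGroup E] [NormedSpace ℝ E] [CompleteSpace E]
  {P : Measure Ω} [IsFiniteMeasure P] {X : T → Ω → E}

/-- **Optional stopping** for a bounded martingale that is almost surely right-continuous: its
value at a stopping time is measurable up to null sets, and on every event about the stopping time
it integrates like the terminal value. The stopping time is approximated from above by stopping
times with countably many values. -/
lemma MeasureTheory.Martingale.optional_stopping (hT : IsCompact T) (hX : Martingale X ℱ P)
    {C : ℝ} (hC : ∀ t ω, ‖X t ω‖ ≤ C)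
    (hr : ∀ᵐ ω ∂P, ∀ t, Tendsto (fun s => X s ω) (𝓝[>] t) (𝓝 (X t ω)))
    (hτ : IsStoppingTime ℱ fun ω => (τ ω : WithTop T)) {M : T} (hM : ∀ t, t ≤ M) :
    AEStronglyMeasurable (fun ω => X (τ ω) ω) P ∧
      ∀ B : Set T, MeasurableSet B →
        ∫ ω in τ ⁻¹' B, X (τ ω) ω ∂P = ∫ ω in τ ⁻¹' B, X M ω ∂P := by
  have := hT.orderTopology_subtype
  have : Nonempty T := ⟨M⟩
  obtain ⟨d, hdm, hdc, hdle, hdt⟩ := hT.exists_discretization ⟨M, M.2⟩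
  have hσ : ∀ n, IsStoppingTime ℱ fun ω => (d n (τ ω) : WithTop T) := fun n s => by
    have h := measurableSet_preimage_of_isStoppingTime hT hτ (s := s)
      (hdm n (measurableSet_Iic (a := s))) fun x hx => (hdle n x).trans hx
    simpa [Set.preimage] using h
  have hce : ∀ n, (fun ω => X (d n (τ ω)) ω) =ᵐ[P] P[X M | (hσ n).measurableSpace] := fun n => by
    have h := hX.stoppedValue_ae_eq_condExp_of_le_const_of_countable_range (hσ n) (n := M)
      (fun ω => by simpa using hM _)
      (((hdc n).image (fun x : T => (x : WithTop T))).mono (by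
        rintro _ ⟨ω, rfl⟩
        exact ⟨_, ⟨_, rfl⟩, rfl⟩))
    exact h
  have hlim : ∀ᵐ ω ∂P, Tendsto (fun n => X (d n (τ ω)) ω) atTop (𝓝 (X (τ ω) ω)) := by
    filter_upwards [hr] with ω hω
    have h : ContinuousWithinAt (fun s => X s ω) (Set.Ici (τ ω)) (τ ω) :=
      continuousWithinAt_Ioi_iff_Ici.1 (hω (τ ω))
    exact h.tendsto.comp
      (tendsto_nhdsWithin_iff.2 ⟨hdt (τ ω), Eventually.of_forall fun n => hdle n (τ ω)⟩)
  have hsm : ∀ n, AEStronglyMeasurable (fun ω => X (d n (τ ω)) ω) P := fun n =>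
    (stronglyMeasurable_condExp.mono (hσ n).measurableSpace_le).aestronglyMeasurable.congr
      (hce n).symm
  refine ⟨aestronglyMeasurable_of_tendsto_ae _ hsm hlim, fun B hB => ?_⟩
  have hBτ : MeasurableSet (τ ⁻¹' B) := measurable_of_isStoppingTime hT hτ hB
  have hint : ∀ n, ∫ ω in τ ⁻¹' B, X (d n (τ ω)) ω ∂P = ∫ ω in τ ⁻¹' B, X M ω ∂P := fun n => by
    have hBσ : MeasurableSet[(hσ n).measurableSpace] (τ ⁻¹' B) := by
      refine ((hσ n).measurableSet _).2 ⟨le_iSup (fun t => ℱ t) M _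
        (measurableSet_preimage_of_isStoppingTime hT hτ hB fun x _ => hM x), fun s => ?_⟩
      have h := measurableSet_preimage_of_isStoppingTime hT hτ (s := s)
        (hB.inter (hdm n (measurableSet_Iic (a := s)))) fun x hx => (hdle n x).trans hx.2
      convert h using 1
      ext ω
      simp
    rw [setIntegral_congr_ae hBτ ((hce n).mono fun ω h _ => h),
      setIntegral_condExp (hσ n).measurableSpace_le (hX.integrable M) hBσ]
  refine tendsto_nhds_unique (tendsto_integral_of_dominated_convergence (fun _ => C)
    (fun n => (hsm n).restrict)
    (integrable_const C) (fun n => ae_of_all _ fun ω => hC _ _) (ae_restrict_of_ae hlim))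
    (tendsto_const_nhds.congr fun n => (hint n).symm)

end OptionalStopping

/-! ### Outcomes of feasible and obedient strategies -/

section Outcome

variable {Θ : Type uState} [Fintype Θ] {A : Type uAction} {T : Set ℝ} {prior : Belief Θ}

lemma measurableSet_stopsAfter (t : T) : MeasurableSet (stopsAfter Θ t) :=
  measurableSet_lt measurable_const measurable_snd

lemma measurable_coe_fst : Measurable fun p : Belief Θ × T => (p.1 : Θ → ℝ) :=
  measurable_subtype_coe.comp measurable_fst

variable {Ω : Type uProb} {mΩ : MeasurableSpace Ω} {P : Measure Ω} {ℱ : Filtration T mΩ}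
  {μ : T → Ω → Belief Θ} {τ τ' : Ω → T}

lemma IsFeasible.optional_stopping [IsProbabilityMeasure P] (hT : IsCompact T)
    (h : IsFeasible prior P ℱ μ τ) (hτ' : IsStoppingTime ℱ fun ω => (τ' ω : WithTop T))
    {M : T} (hM : ∀ t, t ≤ M) :
    AEStronglyMeasurable (fun ω => (μ (τ' ω) ω : Θ → ℝ)) P ∧
      ∀ B : Set T, MeasurableSet B →
        ∫ ω in τ' ⁻¹' B, (μ (τ' ω) ω : Θ → ℝ) ∂P = ∫ ω in τ' ⁻¹' B, (μ M ω : Θ → ℝ) ∂P :=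
  h.martingale.optional_stopping hT (fun _ _ => norm_belief_le _)
    (h.cadlag.mono fun _ hω t => (continuous_subtype_val.tendsto _).comp (hω t).1) hτ' hM

/-- The belief at any stopping time, paired with that time, is a random variable up to null sets. -/
lemma IsFeasible.aemeasurable_stopped [IsProbabilityMeasure P] (hT : IsCompact T)
    (hTne : T.Nonempty) (h : IsFeasible prior P ℱ μ τ)
    (hτ' : IsStoppingTime ℱ fun ω => (τ' ω : WithTop T)) :
    AEMeasurable (fun ω => (μ (τ' ω) ω, τ' ω)) P := by
  obtain ⟨M, hM, hM'⟩ := hT.exists_isGreatest hTne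
  have h1 := (h.optional_stopping hT hτ' (M := ⟨M, hM⟩) fun t => hM' t.2).1
  exact (IsEmbedding.subtypeVal.aestronglyMeasurable_comp_iff.1 h1).aemeasurable.prodMk
    (measurable_of_isStoppingTime hT hτ').aemeasurable

lemma IsFeasible.integrable_agentUtility [IsProbabilityMeasure P] [Nonempty A] (hT : IsCompact T)
    (hTne : T.Nonempty) {u : Θ → A → T → ℝ} (hu : ∃ C : ℝ, ∀ θ a t, |u θ a t| ≤ C)
    (h : IsFeasible prior P ℱ μ τ) (hτ' : IsStoppingTime ℱ fun ω => (τ' ω : WithTop T)) :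
    Integrable (fun ω => agentUtility u (μ (τ' ω) ω) (τ' ω)) P := by
  obtain ⟨C, hC⟩ := hu
  exact Integrable.of_bound ((measurable_agentUtility ⟨C, hC⟩).comp_aemeasurable
    (h.aemeasurable_stopped hT hTne hτ')).aestronglyMeasurable C
    (ae_of_all _ fun ω => abs_agentUtility_le hC (μ (τ' ω) ω).2 _)

theorem IsFeasible.isConsistent_outcomeLaw [IsProbabilityMeasure P] (hT : IsCompact T)
    (hTne : T.Nonempty) (h : IsFeasible prior P ℱ μ τ) :
    IsConsistent prior (outcomeLaw P μ τ) := by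
  obtain ⟨M, hM, hM'⟩ := hT.exists_isGreatest hTne
  have hm := h.aemeasurable_stopped hT hTne h.stopping
  refine ⟨Measure.isProbabilityMeasure_map hm, ?_⟩
  have h1 := (h.optional_stopping hT h.stopping (M := ⟨M, hM⟩) fun t => hM' t.2).2
    Set.univ MeasurableSet.univ
  simp only [Set.preimage_univ, Measure.restrict_univ] at h1
  rw [outcomeLaw, integral_map hm measurable_coe_fst.aestronglyMeasurable, h1, h.mean]

lemma setAverage_outcomeLaw {E : Type*} [NormedAddCommGroup E] [NormedSpace ℝ E]
    (hm : AEMeasurable (fun ω => (μ (τ ω) ω, τ ω)) P) {g : Belief Θ × T → E}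
    (hg : StronglyMeasurable g) (t : T) :
    ⨍ p in stopsAfter Θ t, g p ∂outcomeLaw P μ τ
      = ⨍ ω in {ω | t < τ ω}, g (μ (τ ω) ω, τ ω) ∂P := by
  have hS := measurableSet_stopsAfter (Θ := Θ) t
  rw [setAverage_eq, setAverage_eq, outcomeLaw,
    setIntegral_map hS hg.aestronglyMeasurable hm, measureReal_def, measureReal_def,
    Measure.map_apply_of_aemeasurable hm hS]
  rfl

/-- The agent may deviate to stopping at `t` whenever `τ > t`. By optional stopping the beliefs
`μ_t` and `μ_τ` have the same mean on the event `τ > t`, and `U(·, t)` is convex, so that the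
agent gains at least as much from this deviation as from stopping at `t` with the pooled belief. -/
theorem IsObedient.pooledObedience_outcomeLaw [IsProbabilityMeasure P] [Nonempty A]
    (hT : IsCompact T) (hTne : T.Nonempty) {u : Θ → A → T → ℝ}
    (hu : ∃ C : ℝ, ∀ θ a t, |u θ a t| ≤ C) (h : IsFeasible prior P ℱ μ τ)
    (ho : IsObedient u P ℱ μ τ) : PooledObedience u (outcomeLaw P μ τ) := by
  obtain ⟨M, hM, hM'⟩ := hT.exists_isGreatest hTne
  have hm := h.aemeasurable_stopped hT hTne h.stopping
  intro t ht
  have hEt : MeasurableSet[ℱ t] {ω | t < τ ω} := by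
    convert (h.stopping t).compl using 1
    ext ω
    simp
  have hE : MeasurableSet {ω | t < τ ω} := ℱ.le t _ hEt
  have hP : P {ω | t < τ ω} ≠ 0 := by
    rw [outcomeLaw, Measure.map_apply_of_aemeasurable hm (measurableSet_stopsAfter t)] at ht
    exact ht.ne'
  have hint : Integrable (fun ω => (μ t ω : Θ → ℝ)) P := h.martingale.integrable t
  have hmean : ∫ ω in {ω | t < τ ω}, (μ (τ ω) ω : Θ → ℝ) ∂P
      = ∫ ω in {ω | t < τ ω}, (μ t ω : Θ → ℝ) ∂P :=
    ((h.optional_stopping hT h.stopping (M := ⟨M, hM⟩) fun t => hM' t.2).2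
      (Set.Ioi t) measurableSet_Ioi).trans
      (h.martingale.setIntegral_eq (hM' t.2 : t ≤ ⟨M, hM⟩) hEt).symm
  have hτ' : IsStoppingTime ℱ fun ω => ((min (τ ω) t : T) : WithTop T) := by
    simpa using h.stopping.min_const t
  have hUt : Integrable (fun ω => agentUtility u (μ t ω) t) P :=
    h.integrable_agentUtility hT hTne hu (isStoppingTime_const ℱ t)
  have hUτ := h.integrable_agentUtility hT hTne hu h.stopping
  have hdev : ∫ ω in {ω | t < τ ω}, agentUtility u (μ t ω) t ∂P
      ≤ ∫ ω in {ω | t < τ ω}, agentUtility u (μ (τ ω) ω) (τ ω) ∂P := by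
    have h1 := ho _ hτ'
    rw [← integral_add_compl hE hUτ,
      ← integral_add_compl hE (h.integrable_agentUtility hT hTne hu hτ')] at h1
    have h2 : ∫ ω in {ω | t < τ ω}, agentUtility u (μ (min (τ ω) t) ω) (min (τ ω) t) ∂P
        = ∫ ω in {ω | t < τ ω}, agentUtility u (μ t ω) t ∂P :=
      setIntegral_congr_fun hE fun ω hω => by
        have : min (τ ω) t = t := min_eq_right (le_of_lt hω)
        simp only [this]
    have h3 : ∫ ω in {ω | t < τ ω}ᶜ, agentUtility u (μ (min (τ ω) t) ω) (min (τ ω) t) ∂P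
        = ∫ ω in {ω | t < τ ω}ᶜ, agentUtility u (μ (τ ω) ω) (τ ω) ∂P :=
      setIntegral_congr_fun hE.compl fun ω hω => by
        have : min (τ ω) t = τ ω := min_eq_left (not_lt.1 hω)
        simp only [this]
    rw [h2, h3] at h1
    exact le_of_add_le_add_right h1
  rw [pooledBelief, setAverage_outcomeLaw hm measurable_coe_fst.stronglyMeasurable,
    setAverage_outcomeLaw hm (measurable_agentUtility hu).stronglyMeasurable]
  have hav : ⨍ ω in {ω | t < τ ω}, (μ (τ ω) ω : Θ → ℝ) ∂P
      = ⨍ ω in {ω | t < τ ω}, (μ t ω : Θ → ℝ) ∂P := by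
    rw [setAverage_eq, setAverage_eq, hmean]
  rw [hav]
  calc agentUtility u (⨍ ω in {ω | t < τ ω}, (μ t ω : Θ → ℝ) ∂P) t
      ≤ ⨍ ω in {ω | t < τ ω}, agentUtility u (μ t ω) t ∂P :=
        (convexOn_agentUtility hu t).map_set_average_le
          (continuous_agentUtility hu t).continuousOn isClosed_univ hP (measure_ne_top _ _)
          (ae_of_all _ fun _ => Set.mem_univ _) hint.integrableOn hUt.integrableOn
    _ ≤ ⨍ ω in {ω | t < τ ω}, agentUtility u (μ (τ ω) ω) (τ ω) ∂P := by
        rw [setAverage_eq, setAverage_eq]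
        exact smul_le_smul_of_nonneg_left hdev (inv_nonneg.2 measureReal_nonneg)

end Outcome

/-! ### The events that stopping occurs late -/

section Tails

variable {Θ : Type uState} [Fintype Θ] {T : Set ℝ}

/-- If the events `τ > r` converge to `D` along `l`, so do the integrals over them. -/
lemma tendsto_setIntegral_stopsAfter (f : Measure (Belief Θ × T)) {E : Type*}
    [NormedAddCommGroup E] [NormedSpace ℝ E]
    {l : Filter T} [l.IsCountablyGenerated] {D : Set (Belief Θ × T)} (hD : MeasurableSet D)
    (h : ∀ p, ∀ᶠ r in l, r < p.2 ↔ p ∈ D) {g : Belief Θ × T → E} (hg : Integrable g f) :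
    Tendsto (fun r => ∫ p in stopsAfter Θ r, g p ∂f) l (𝓝 (∫ p in D, g p ∂f)) := by
  simp only [← integral_indicator hD, ← integral_indicator (measurableSet_stopsAfter _)]
  refine tendsto_integral_filter_of_dominated_convergence (fun p => ‖g p‖)
    (Eventually.of_forall fun r =>
      (hg.indicator (measurableSet_stopsAfter r)).aestronglyMeasurable)
    (Eventually.of_forall fun r => ae_of_all _ fun p => norm_indicator_le_norm_self _ _)
    hg.norm (ae_of_all _ fun p => ?_)
  refine tendsto_const_nhds.congr' ((h p).mono fun r hr => ?_)
  by_cases hp : p ∈ D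
  · dsimp only
    rw [Set.indicator_of_mem hp, Set.indicator_of_mem (show p ∈ stopsAfter Θ r from hr.2 hp)]
  · dsimp only
    rw [Set.indicator_of_notMem hp,
      Set.indicator_of_notMem (show p ∉ stopsAfter Θ r from fun h' => hp (hr.1 h'))]

/-- Almost surely, stopping no earlier than at the realized time has positive probability. -/
lemma ae_measure_ge_pos (f : Measure (Belief Θ × T)) : ∀ᵐ p ∂f, 0 < f {q | p.2 ≤ q.2} := by
  let N : Set T := {y | f {q : Belief Θ × T | y ≤ q.2} = 0}
  obtain ⟨C, hCN, hC, hCU⟩ := TopologicalSpace.isOpen_biUnion_countable N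
    (fun y => Set.Ioi y) (fun _ _ => isOpen_Ioi)
  have h1 : f (⋃ y ∈ C, {q : Belief Θ × T | y ≤ q.2}) = 0 :=
    (measure_biUnion_null_iff hC).2 fun y hy => hCN hy
  -- at most the least element of `N` is missed by the rays `(y, ∞)`, `y ∈ N`
  have h2 : f {q : Belief Θ × T | q.2 ∈ N ∧ ∀ y ∈ N, q.2 ≤ y} = 0 := by
    rcases Set.eq_empty_or_nonempty {q : Belief Θ × T | q.2 ∈ N ∧ ∀ y ∈ N, q.2 ≤ y} with h | ⟨q, hq⟩
    · rw [h, measure_empty]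
    · exact measure_mono_null (fun r hr => hq.2 _ hr.1) hq.1
  rw [ae_iff]
  refine measure_mono_null (fun q hq => ?_) (measure_union_null h1 h2)
  have hqN : q.2 ∈ N := nonpos_iff_eq_zero.1 (not_lt.1 hq)
  by_cases hmin : ∀ y ∈ N, q.2 ≤ y
  · exact Or.inr ⟨hqN, hmin⟩
  · push Not at hmin
    obtain ⟨y, hy, hyq⟩ := hmin
    have hmem : q.2 ∈ ⋃ y ∈ N, Set.Ioi y := Set.mem_biUnion hy hyq
    rw [← hCU] at hmem
    obtain ⟨z, hz, hzq⟩ := Set.mem_iUnion₂.1 hmem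
    exact Or.inl (Set.mem_biUnion hz (show z ≤ q.2 from le_of_lt hzq))

end Tails

/-! ### The simple recommendation is a feasible strategy -/

section Simple

variable {Θ : Type uState} [Fintype Θ] {A : Type uAction} {T : Set ℝ}

variable (prior : Belief Θ) (f : Measure (Belief Θ × T)) [IsProbabilityMeasure f]

lemma integrable_coe_fst : Integrable (fun p : Belief Θ × T => (p.1 : Θ → ℝ)) f :=
  Integrable.of_bound measurable_coe_fst.aestronglyMeasurable 1
    (ae_of_all _ fun _ => norm_belief_le _)

lemma simpleBelief_of_lt {s : T} {p : Belief Θ × T} (h : s < p.2) :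
    simpleBelief prior f s p = continuationBelief prior f s := if_pos h

lemma simpleBelief_of_le {s : T} {p : Belief Θ × T} (h : p.2 ≤ s) :
    simpleBelief prior f s p = p.1 := if_neg h.not_gt

lemma outcomeLaw_simpleBelief : outcomeLaw f (simpleBelief prior f) simpleTime = f := by
  have h : (fun p : Belief Θ × T =>
      (simpleBelief prior f (simpleTime p) p, simpleTime p)) = id := by
    funext p
    rw [simpleBelief_of_le prior f (p := p) (s := simpleTime p) le_rfl]
    rfl
  rw [outcomeLaw, h, Measure.map_id]

lemma measurable_simpleBelief_prodMk (t : T) : Measurable[simpleFiltration prior f t]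
    fun p => (simpleBelief prior f t p, (simpleTime p ≤ t : Prop)) :=
  (comap_measurable _).mono
    (le_iSup₂ (f := fun s (_ : s ≤ t) => MeasurableSpace.comap
      (fun p => (simpleBelief prior f s p, (simpleTime p ≤ s : Prop))) inferInstance) t le_rfl)
    le_rfl

lemma isStoppingTime_simpleTime :
    IsStoppingTime (simpleFiltration prior f) fun p => (simpleTime p : WithTop T) := fun t => by
  have h := (measurable_simpleBelief_prodMk prior f t).snd
  simpa using (@measurableSet_setOfPred _ (simpleFiltration prior f t) _).2 h

/-- An agent not yet told to stop cannot tell apart the realizations `(μ, τ)`: the beliefs observed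
so far are deterministic. -/
lemma mem_of_measurableSet_simpleFiltration {t : T} {B : Set (Belief Θ × T)}
    (hB : MeasurableSet[simpleFiltration prior f t] B) {p q : Belief Θ × T} (hp : t < p.2)
    (hq : t < q.2) (hpB : p ∈ B) : q ∈ B := by
  let N : MeasurableSpace (Belief Θ × T) :=
    { MeasurableSet' := fun B => ∀ p q : Belief Θ × T, t < p.2 → t < q.2 → p ∈ B → q ∈ B
      measurableSet_empty := fun _ _ _ _ h => h
      measurableSet_compl := fun B hB p q hp hq h h' => h (hB q p hq hp h')
      measurableSet_iUnion := fun B hB p q hp hq h => by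
        obtain ⟨i, hi⟩ := Set.mem_iUnion.1 h
        exact Set.mem_iUnion.2 ⟨i, hB i p q hp hq hi⟩ }
  have hle : (simpleFiltration prior f t : MeasurableSpace (Belief Θ × T)) ≤ N := by
    refine iSup₂_le fun s hs => ?_
    rintro _ ⟨D, -, rfl⟩ p q hp hq hpD
    have h1 : ∀ r : Belief Θ × T, t < r.2 →
        (simpleBelief prior f s r, (simpleTime r ≤ s : Prop))
          = (continuationBelief prior f s, False) := fun r hr => by
      rw [simpleBelief_of_lt prior f (hs.trans_lt hr), Prod.mk.injEq]
      exact ⟨rfl, eq_false (hs.trans_lt hr).not_ge⟩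
    rw [Set.mem_preimage, h1 p hp] at hpD
    rwa [Set.mem_preimage, h1 q hq]
  exact hle B hB p q hp hq hpB

lemma coe_continuationBelief {t : T} (h : 0 < f (stopsAfter Θ t)) :
    (continuationBelief prior f t : Θ → ℝ) = pooledBelief f t := by
  rw [continuationBelief, dif_pos h]
  rfl

lemma setIntegral_continuationBelief (t : T) :
    ∫ _ in stopsAfter Θ t, (continuationBelief prior f t : Θ → ℝ) ∂f
      = ∫ p in stopsAfter Θ t, (p.1 : Θ → ℝ) ∂f := by
  rcases eq_or_ne (f (stopsAfter Θ t)) 0 with h | h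
  · rw [setIntegral_measure_zero _ h, setIntegral_measure_zero _ h]
  · rw [coe_continuationBelief prior f (pos_iff_ne_zero.2 h), setIntegral_const, pooledBelief,
      measure_smul_setAverage _ (measure_ne_top _ _)]

lemma measurable_simpleBelief (t : T) : Measurable (simpleBelief prior f t) :=
  (measurable_simpleBelief_prodMk prior f t).fst.mono ((simpleFiltration prior f).le t) le_rfl

lemma integrable_simpleBelief (t : T) :
    Integrable (fun p => (simpleBelief prior f t p : Θ → ℝ)) f :=
  Integrable.of_bound
    (measurable_subtype_coe.comp (measurable_simpleBelief prior f t)).aestronglyMeasurable 1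
    (ae_of_all _ fun _ => norm_belief_le _)

/-- On an event known at a time `s ≤ t`, the time-`t` belief of the simple recommendation has the
same integral as the belief with which the agent eventually stops: such an event contains
all of `τ > s` or none of it. -/
lemma setIntegral_simpleBelief {s t : T} (hst : s ≤ t) {B : Set (Belief Θ × T)}
    (hB : MeasurableSet[simpleFiltration prior f s] B) :
    ∫ p in B, (simpleBelief prior f t p : Θ → ℝ) ∂f = ∫ p in B, (p.1 : Θ → ℝ) ∂f := by
  have hBm : MeasurableSet B := (simpleFiltration prior f).le s _ hB
  have hS := measurableSet_stopsAfter (Θ := Θ) t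
  rw [← integral_inter_add_sdiff hS (integrable_simpleBelief prior f t).integrableOn,
    ← integral_inter_add_sdiff hS (integrable_coe_fst f).integrableOn]
  congr 1
  · have h1 : ∫ p in B ∩ stopsAfter Θ t, (simpleBelief prior f t p : Θ → ℝ) ∂f
        = ∫ p in B ∩ stopsAfter Θ t, (continuationBelief prior f t : Θ → ℝ) ∂f :=
      setIntegral_congr_fun (hBm.inter hS) fun p hp => by
        simp only [simpleBelief_of_lt prior f (show t < p.2 from hp.2)]
    rw [h1]
    rcases (B ∩ stopsAfter Θ t).eq_empty_or_nonempty with h | ⟨p, hpB, hp⟩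
    · simp [h]
    · have h2 : B ∩ stopsAfter Θ t = stopsAfter Θ t :=
        Set.inter_eq_right.2 fun q hq => mem_of_measurableSet_simpleFiltration prior f hB
          (hst.trans_lt hp) (hst.trans_lt hq) hpB
      rw [h2, setIntegral_continuationBelief]
  · exact setIntegral_congr_fun (hBm.diff hS) fun p hp => by
      simp only [simpleBelief_of_le prior f (not_lt.1 hp.2)]

lemma martingale_simpleBelief :
    Martingale (fun t p => (simpleBelief prior f t p : Θ → ℝ)) (simpleFiltration prior f) f := by
  have had : ∀ t, StronglyMeasurable[simpleFiltration prior f t]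
      fun p => (simpleBelief prior f t p : Θ → ℝ) := fun t =>
    (measurable_subtype_coe.comp (measurable_simpleBelief_prodMk prior f t).fst).stronglyMeasurable
  refine ⟨had, fun s t hst => ?_⟩
  refine (ae_eq_condExp_of_forall_setIntegral_eq ((simpleFiltration prior f).le s)
    (integrable_simpleBelief prior f t)
    (fun _ _ _ => (integrable_simpleBelief prior f s).integrableOn) (fun B hB _ => ?_)
    (had s).aestronglyMeasurable).symm
  rw [setIntegral_simpleBelief prior f le_rfl hB, setIntegral_simpleBelief prior f hst hB]

lemma integral_simpleBelief (hf : IsConsistent prior f) (t : T) :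
    ∫ p, (simpleBelief prior f t p : Θ → ℝ) ∂f = prior := by
  have h := setIntegral_simpleBelief prior f (le_refl t)
    (@MeasurableSet.univ _ (simpleFiltration prior f t))
  rw [Measure.restrict_univ] at h
  exact h.trans hf.mean

/-! ### Regularity of the continuation belief -/

lemma tendsto_pooledBelief {l : Filter T} [l.IsCountablyGenerated] {D : Set (Belief Θ × T)}
    (hD : MeasurableSet D) (h : ∀ p, ∀ᶠ r in l, r < p.2 ↔ p ∈ D) (hpos : 0 < f D) :
    Tendsto (pooledBelief f) l (𝓝 (⨍ p in D, (p.1 : Θ → ℝ) ∂f)) := by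
  have h1 := tendsto_setIntegral_stopsAfter f hD h (integrable_const (1 : ℝ))
  simp only [setIntegral_const, smul_eq_mul, mul_one] at h1
  have h0 : f.real D ≠ 0 := (ENNReal.toReal_pos hpos.ne' (measure_ne_top _ _)).ne'
  have h2 := (h1.inv₀ h0).smul (tendsto_setIntegral_stopsAfter f hD h (integrable_coe_fst f))
  rw [setAverage_eq]
  exact h2.congr fun r => (setAverage_eq _ _ _).symm

/-- The limit is taken in the simplex. Along the trivial filter, which occurs at points of `T` that
are isolated on one side, nothing pins it down. -/
lemma exists_tendsto_continuationBelief {l : Filter T} [l.IsCountablyGenerated]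
    {D : Set (Belief Θ × T)} (hD : MeasurableSet D) (h : ∀ p, ∀ᶠ r in l, r < p.2 ↔ p ∈ D)
    (hpos : 0 < f D) (hl : ∀ᶠ r in l, 0 < f (stopsAfter Θ r)) :
    ∃ b : Belief Θ, (l ≠ ⊥ → (b : Θ → ℝ) = ⨍ p in D, (p.1 : Θ → ℝ) ∂f) ∧
      Tendsto (continuationBelief prior f) l (𝓝 b) := by
  rcases eq_or_neBot l with rfl | hne
  · exact ⟨prior, fun h => absurd rfl h, tendsto_bot⟩
  have ht : Tendsto (fun r => (continuationBelief prior f r : Θ → ℝ)) l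
      (𝓝 (⨍ p in D, (p.1 : Θ → ℝ) ∂f)) :=
    (tendsto_pooledBelief f hD h hpos).congr'
      (hl.mono fun r hr => (coe_continuationBelief prior f hr).symm)
  exact ⟨⟨_, (isClosed_stdSimplex ℝ Θ).mem_of_tendsto ht
    (Eventually.of_forall fun r => (continuationBelief prior f r).2)⟩, fun _ => rfl,
    tendsto_subtype_rng.2 ht⟩

lemma ae_isCadlagPath_simpleBelief :
    ∀ᵐ p ∂f, IsCadlagPath fun t => simpleBelief prior f t p := by
  refine (ae_measure_ge_pos f).mono fun p hp t => ?_
  have hlt : ∀ {r : T}, r < p.2 → 0 < f (stopsAfter Θ r) := fun hr =>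
    hp.trans_le (measure_mono fun q hq => lt_of_lt_of_le hr hq)
  constructor
  · rcases le_or_gt p.2 t with h | h
    · refine tendsto_const_nhds.congr' (eventually_nhdsWithin_of_forall fun r hr => ?_)
      dsimp only
      rw [simpleBelief_of_le prior f h, simpleBelief_of_le prior f (h.trans (le_of_lt hr))]
    · rcases eq_or_ne (𝓝[>] t) ⊥ with hbot | hbot
      · rw [hbot]
        exact tendsto_bot
      have hev : ∀ᶠ r in 𝓝[>] t, r < p.2 := mem_nhdsWithin_of_mem_nhds (Iio_mem_nhds h)
      obtain ⟨b, hb, htb⟩ := exists_tendsto_continuationBelief prior f (l := 𝓝[>] t)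
        (measurableSet_stopsAfter t) (fun q => by
          rcases lt_or_ge t q.2 with hq | hq
          · exact Eventually.mono (mem_nhdsWithin_of_mem_nhds (Iio_mem_nhds hq)) fun r hr =>
              iff_of_true hr hq
          · exact eventually_nhdsWithin_of_forall fun r hr =>
              iff_of_false (hq.trans (le_of_lt hr)).not_gt hq.not_gt)
        (hlt h) (hev.mono fun r hr => hlt hr)
      have hbt : b = simpleBelief prior f t p := by
        rw [simpleBelief_of_lt prior f h]
        exact Subtype.ext ((hb hbot).trans (coe_continuationBelief prior f (hlt h)).symm)
      dsimp only
      rw [← hbt]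
      exact htb.congr' (hev.mono fun r hr => (simpleBelief_of_lt prior f hr).symm)
  · rcases lt_or_ge p.2 t with h | h
    · refine ⟨p.1, tendsto_const_nhds.congr' ?_⟩
      filter_upwards [mem_nhdsWithin_of_mem_nhds (Ioi_mem_nhds h)] with r hr
      exact (simpleBelief_of_le prior f (le_of_lt hr)).symm
    · obtain ⟨b, -, htb⟩ := exists_tendsto_continuationBelief prior f (l := 𝓝[<] t)
        (D := {q | t ≤ q.2}) (measurableSet_le measurable_const measurable_snd) (fun q => by
          rcases le_or_gt t q.2 with hq | hq
          · exact eventually_nhdsWithin_of_forall fun r hr =>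
              iff_of_true (lt_of_lt_of_le hr hq) hq
          · exact Eventually.mono (mem_nhdsWithin_of_mem_nhds (Ioi_mem_nhds hq)) fun r hr =>
              iff_of_false (le_of_lt hr).not_gt hq.not_ge)
        (hp.trans_le (measure_mono fun q hq => h.trans hq))
        (eventually_nhdsWithin_of_forall fun r hr => hlt (lt_of_lt_of_le hr h))
      exact ⟨b, htb.congr' (eventually_nhdsWithin_of_forall fun r hr =>
        (simpleBelief_of_lt prior f (lt_of_lt_of_le hr h)).symm)⟩

theorem isFeasible_simpleBelief (hf : IsConsistent prior f) :
    IsFeasible prior f (simpleFiltration prior f) (simpleBelief prior f) simpleTime where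
  martingale := martingale_simpleBelief prior f
  cadlag := ae_isCadlagPath_simpleBelief prior f
  mean := integral_simpleBelief prior f hf
  stopping := isStoppingTime_simpleTime prior f

/-! ### The simple recommendation is obedient -/

/-- A stopping time that disobeys some recommendation to continue stops at the same deterministic
time on every path not told to stop by then. -/
lemma eq_of_lt_of_isStoppingTime {τ' : Belief Θ × T → T}
    (hτ' : IsStoppingTime (simpleFiltration prior f) fun p => (τ' p : WithTop T))
    {p q : Belief Θ × T} (hp : τ' p < p.2) (hq : τ' p < q.2) : τ' q = τ' p := by
  have key : ∀ {p q : Belief Θ × T}, τ' p < p.2 → τ' p < q.2 → τ' q ≤ τ' p := fun {p q} hp hq => by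
    have h := mem_of_measurableSet_simpleFiltration prior f (hτ' (τ' p)) hp hq
      (le_refl (τ' p : WithTop T))
    simpa using h
  have h := key hp hq
  exact le_antisymm h (key (h.trans_lt hq) (h.trans_lt hp))

/-- A stopping time either never stops before being told to, or stops at a deterministic time
`s` on the event `τ > s` and not before being told to on its complement. Delay costs the
agent action times, and the pooled constraint rules out a gain on `τ > s`. -/
theorem isObedient_simpleBelief [Nonempty A] (hT : IsCompact T) (hTne : T.Nonempty)
    {u : Θ → A → T → ℝ} (hu : ∃ C : ℝ, ∀ θ a t, |u θ a t| ≤ C) (hf : IsConsistent prior f)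
    (hpool : PooledObedience u f) :
    IsObedient u f (simpleFiltration prior f) (simpleBelief prior f) simpleTime := by
  have hfeas := isFeasible_simpleBelief prior f hf
  intro τ' hτ'
  have hI' := hfeas.integrable_agentUtility hT hTne hu hτ'
  have hI := hfeas.integrable_agentUtility hT hTne hu hfeas.stopping
  have hlate : ∀ q : Belief Θ × T, q.2 ≤ τ' q →
      agentUtility u (simpleBelief prior f (τ' q) q) (τ' q)
        ≤ agentUtility u (simpleBelief prior f (simpleTime q) q) (simpleTime q) := fun q hq => by
    rw [simpleBelief_of_le prior f hq, simpleBelief_of_le prior f (s := simpleTime q) le_rfl]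
    exact agentUtility_antitone hu _ hq
  by_cases hex : ∃ p : Belief Θ × T, τ' p < p.2
  · obtain ⟨p, hp⟩ := hex
    set s := τ' p
    have hS := measurableSet_stopsAfter (Θ := Θ) s
    rw [← integral_add_compl hS hI', ← integral_add_compl hS hI]
    refine add_le_add ?_ (setIntegral_mono_on hI'.integrableOn hI.integrableOn hS.compl
      fun q hq => hlate q ?_)
    · have h1 : ∫ q in stopsAfter Θ s,
            agentUtility u (simpleBelief prior f (τ' q) q) (τ' q) ∂f
          = ∫ _ in stopsAfter Θ s, agentUtility u (continuationBelief prior f s) s ∂f :=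
        setIntegral_congr_fun hS fun q hq => by
          simp only [eq_of_lt_of_isStoppingTime prior f hτ' hp hq]
          rw [simpleBelief_of_lt prior f hq]
      have h2 : ∫ q in stopsAfter Θ s,
            agentUtility u (simpleBelief prior f (simpleTime q) q) (simpleTime q) ∂f
          = ∫ q in stopsAfter Θ s, agentUtility u q.1 q.2 ∂f :=
        setIntegral_congr_fun hS fun q _ => by
          simp only [simpleBelief_of_le prior f (p := q) (s := simpleTime q) le_rfl]
          rfl
      rw [h1, h2]
      rcases eq_or_ne (f (stopsAfter Θ s)) 0 with h0 | h0
      · rw [setIntegral_measure_zero _ h0, setIntegral_measure_zero _ h0]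
      · have hpos := pos_iff_ne_zero.2 h0
        rw [setIntegral_const, coe_continuationBelief prior f hpos,
          ← measure_smul_setAverage _ (measure_ne_top f _)]
        exact smul_le_smul_of_nonneg_left (hpool s hpos) measureReal_nonneg
    · -- stopping before being told to on this path would mean stopping at that earlier time on
      -- the path `p` as well
      by_contra hlt
      have hq' : q.2 ≤ s := not_lt.1 hq
      have hlt' : τ' q < q.2 := not_le.1 hlt
      have hps : τ' q < p.2 := (hlt'.trans_le hq').trans hp
      exact (hlt'.trans_le hq').ne' (eq_of_lt_of_isStoppingTime prior f hτ' hlt' hps)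
  · push Not at hex
    exact integral_mono hI' hI fun q => hlate q (hex q)

end Simple

/-! ### The reduced problem -/

section Reduced

variable {Θ : Type uState} [Fintype Θ] {A : Type uAction} {T : Set ℝ} {prior : Belief Θ}

/-- Where stopping after `t` has positive probability, the two constraints differ by the factor
`f(τ > t)`; elsewhere, in particular at `sup T`, both are void. -/
theorem IsConsistent.pooledObedience_iff (hT : IsCompact T) {u : Θ → A → T → ℝ}
    {f : Measure (Belief Θ × T)} (hf : IsConsistent prior f) :
    PooledObedience u f ↔ ReducedObedience u f := by
  have := hf.prob
  have hext : ∀ t, 0 < f (stopsAfter Θ t) →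
      agentUtilityExt u (∫ p in stopsAfter Θ t, (p.1 : Θ → ℝ) ∂f) t
        = f.real (stopsAfter Θ t) * agentUtility u (pooledBelief f t) t := fun t ht => by
    have h1 : ∫ p in stopsAfter Θ t, (p.1 : Θ → ℝ) ∂f
        = f.real (stopsAfter Θ t) • pooledBelief f t :=
      (measure_smul_setAverage _ (measure_ne_top _ _)).symm
    have h0 : f.real (stopsAfter Θ t) ≠ 0 :=
      (ENNReal.toReal_pos ht.ne' (measure_ne_top _ _)).ne'
    have hsum : ∑ θ, (f.real (stopsAfter Θ t) • pooledBelief f t) θ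
        = f.real (stopsAfter Θ t) := by
      simp only [Pi.smul_apply, smul_eq_mul, ← Finset.mul_sum]
      rw [(pooledBelief_mem f t ht).2, mul_one]
    rw [agentUtilityExt, h1, hsum, inv_smul_smul₀ h0]
  have hint : ∀ t, ∫ p in stopsAfter Θ t, agentUtility u p.1 p.2 ∂f
      = f.real (stopsAfter Θ t) * ⨍ p in stopsAfter Θ t, agentUtility u p.1 p.2 ∂f := fun t =>
    (measure_smul_setAverage _ (measure_ne_top _ _)).symm
  constructor
  · intro h t _
    rcases eq_or_ne (f (stopsAfter Θ t)) 0 with h0 | h0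
    · rw [setIntegral_measure_zero _ h0, setIntegral_measure_zero _ h0]
      simp [agentUtilityExt]
    · have hpos := pos_iff_ne_zero.2 h0
      rw [hext t hpos, hint t]
      exact mul_le_mul_of_nonneg_left (h t hpos) measureReal_nonneg
  · intro h t ht
    have hne : (t : ℝ) ≠ sSup T := fun hsup => by
      have hempty : stopsAfter Θ t = ∅ := Set.eq_empty_of_forall_notMem fun p hp =>
        not_lt.2 (hsup ▸ le_csSup hT.bddAbove p.2.2 : (p.2 : ℝ) ≤ t) hp
      rw [hempty, measure_empty] at ht
      exact ht.false
    have h1 := h t hne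
    rw [hext t ht, hint t] at h1
    exact le_of_mul_le_mul_left h1 (ENNReal.toReal_pos ht.ne' (measure_ne_top _ _))

/-- Stopping at the initial time without information. -/
lemma isConsistent_dirac (prior : Belief Θ) (t : T) :
    IsConsistent prior (Measure.dirac (prior, t)) where
  prob := inferInstance
  mean := integral_dirac' _ _ measurable_coe_fst.stronglyMeasurable

lemma pooledObedience_dirac (prior : Belief Θ) (u : Θ → A → T → ℝ) {t₀ : T}
    (h : ∀ t : T, t₀ ≤ t) : PooledObedience u (Measure.dirac (prior, t₀)) := fun t ht => by
  rw [Measure.dirac_apply' _ (measurableSet_stopsAfter t),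
    Set.indicator_of_notMem (show (prior, t₀) ∉ stopsAfter Θ t from (h t).not_gt)] at ht
  exact absurd ht (lt_irrefl _)

variable {Ω : Type uProb} {mΩ : MeasurableSpace Ω} {P : Measure Ω} [IsProbabilityMeasure P]
  {ℱ : Filtration T mΩ} {μ : T → Ω → Belief Θ} {τ : Ω → T}

lemma IsFeasible.reducedPayoff_outcomeLaw (hT : IsCompact T) (hTne : T.Nonempty)
    {u v : Θ → A → T → ℝ}
    (hV : Measurable fun p : Belief Θ × T => principalUtility u v p.1 p.2)
    (h : IsFeasible prior P ℱ μ τ) :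
    reducedPayoff u v (outcomeLaw P μ τ) = principalPayoff u v P μ τ :=
  integral_map (h.aemeasurable_stopped hT hTne h.stopping) hV.aestronglyMeasurable

theorem valuesP_eq_valuesR [Nonempty A] (hT : IsCompact T) (hTne : T.Nonempty)
    {u v : Θ → A → T → ℝ} (hu : ∃ C : ℝ, ∀ θ a t, |u θ a t| ≤ C)
    (hV : Measurable fun p : Belief Θ × T => principalUtility u v p.1 p.2) (prior : Belief Θ) :
    valuesP u v prior = valuesR u v prior := by
  ext r
  constructor
  · rintro ⟨Ω, mΩ, P, ℱ, μ, τ, hP, h, ho, rfl⟩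
    have hc := h.isConsistent_outcomeLaw hT hTne
    exact ⟨_, hc, (hc.pooledObedience_iff hT).1 (ho.pooledObedience_outcomeLaw hT hTne hu h),
      (h.reducedPayoff_outcomeLaw hT hTne hV).symm⟩
  · rintro ⟨f, hf, hr, rfl⟩
    have := hf.prob
    have h := isFeasible_simpleBelief prior f hf
    refine ⟨_, _, f, _, _, _, this, h, isObedient_simpleBelief prior f hT hTne hu hf
      ((hf.pooledObedience_iff hT).2 hr), ?_⟩
    rw [← h.reducedPayoff_outcomeLaw hT hTne hV, outcomeLaw_simpleBelief]

/-- Problem (R) is feasible and its objective is bounded. -/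
lemma exists_isLUB_valuesR [Nonempty A] (hT : IsCompact T) (hTne : T.Nonempty)
    {u v : Θ → A → T → ℝ} (hv : ∃ C : ℝ, ∀ θ a t, |v θ a t| ≤ C) (prior : Belief Θ) :
    ∃ r, IsLUB (valuesR u v prior) r := by
  obtain ⟨t₀, ht₀, hmin⟩ := hT.exists_isLeast hTne
  obtain ⟨C, hC⟩ := hv
  refine Real.exists_isLUB ?_ ⟨|C|, ?_⟩
  · have hc := isConsistent_dirac prior (⟨t₀, ht₀⟩ : T)
    exact ⟨_, _, hc, (hc.pooledObedience_iff hT).1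
      (pooledObedience_dirac prior u fun t => hmin t.2), rfl⟩
  · rintro _ ⟨f, hf, -, rfl⟩
    have := hf.prob
    have h := norm_integral_le_of_norm_le_const (μ := f) (C := |C|)
      (f := fun p : Belief Θ × T => principalUtility u v p.1 p.2)
      (ae_of_all _ fun p => abs_principalUtility_le (abs_nonneg C)
        (fun θ a t => (hC θ a t).trans (le_abs_self C)) p.1.2 p.2)
    rw [probReal_univ, mul_one] at h
    exact (le_abs_self _).trans h

theorem IsFeasible.solvesP_iff [Nonempty A] (hT : IsCompact T) (hTne : T.Nonempty)
    {u v : Θ → A → T → ℝ} (hu : ∃ C : ℝ, ∀ θ a t, |u θ a t| ≤ C)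
    (hV : Measurable fun p : Belief Θ × T => principalUtility u v p.1 p.2)
    (h : IsFeasible prior P ℱ μ τ) (ho : IsObedient u P ℱ μ τ) :
    SolvesP u v prior P ℱ μ τ ↔ SolvesR u v prior (outcomeLaw P μ τ) := by
  have hc := h.isConsistent_outcomeLaw hT hTne
  have hr := (hc.pooledObedience_iff hT).1 (ho.pooledObedience_outcomeLaw hT hTne hu h)
  rw [SolvesP, SolvesR, valuesP_eq_valuesR hT hTne hu hV, h.reducedPayoff_outcomeLaw hT hTne hV]
  exact ⟨fun hs => ⟨hc, hr, hs.2.2⟩, fun hs => ⟨h, ho, hs.2.2⟩⟩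

end Reduced

theorem lemma1 {Θ : Type uState} [Fintype Θ] {A : Type uAction} [Nonempty A]
    (T : Set ℝ) (hT : IsCompact T) (hTne : T.Nonempty) (hT0 : ∀ t ∈ T, 0 ≤ t)
    (u v : Θ → A → T → ℝ)
    (hu : ∃ C : ℝ, ∀ θ a t, |u θ a t| ≤ C) (hv : ∃ C : ℝ, ∀ θ a t, |v θ a t| ≤ C)
    (hV : Measurable fun p : Belief Θ × T => principalUtility u v p.1 p.2)
    (prior : Belief Θ) :
    -- the outcome of every feasible obedient strategy is consistent and pooled-obedient
    (∀ {Ω : Type uProb} {mΩ : MeasurableSpace Ω} (P : Measure Ω) [IsProbabilityMeasure P]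
        (ℱ : Filtration T mΩ) (μ : T → Ω → Belief Θ) (τ : Ω → T),
        IsFeasible prior P ℱ μ τ → IsObedient u P ℱ μ τ →
          IsConsistent prior (outcomeLaw P μ τ) ∧ PooledObedience u (outcomeLaw P μ τ)) ∧
    -- conversely, the simple recommendation is feasible, obedient, and has outcome `f`
    (∀ (f : Measure (Belief Θ × T)) [IsProbabilityMeasure f],
        IsConsistent prior f → PooledObedience u f →
          IsFeasible prior f (simpleFiltration prior f) (simpleBelief prior f) simpleTime ∧
          IsObedient u f (simpleFiltration prior f) (simpleBelief prior f) simpleTime ∧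
          outcomeLaw f (simpleBelief prior f) simpleTime = f) ∧
    -- the two forms of the pooled constraint agree
    (∀ f : Measure (Belief Θ × T), IsConsistent prior f →
        (PooledObedience u f ↔ ReducedObedience u f)) ∧
    -- problems (P) and (R) have the same finite value
    (∃ r : ℝ, IsLUB (valuesP u v prior) r ∧ IsLUB (valuesR u v prior) r) ∧
    -- a feasible obedient strategy solves (P) if and only if its outcome solves (R)
    (∀ {Ω : Type uProb} {mΩ : MeasurableSpace Ω} (P : Measure Ω) [IsProbabilityMeasure P]
        (ℱ : Filtration T mΩ) (μ : T → Ω → Belief Θ) (τ : Ω → T),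
        IsFeasible prior P ℱ μ τ → IsObedient u P ℱ μ τ →
          (SolvesP u v prior P ℱ μ τ ↔ SolvesR u v prior (outcomeLaw P μ τ))) ∧
    -- `f` solves (R) if and only if its simple recommendation solves (P)
    (∀ (f : Measure (Belief Θ × T)) [IsProbabilityMeasure f], IsConsistent prior f →
        (SolvesR u v prior f ↔
          SolvesP u v prior f (simpleFiltration prior f) (simpleBelief prior f) simpleTime)) := by
  
  refine ⟨fun P _ ℱ μ τ h ho => ⟨h.isConsistent_outcomeLaw hT hTne,
      ho.pooledObedience_outcomeLaw hT hTne hu h⟩,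
    fun f _ hf hp => ⟨isFeasible_simpleBelief prior f hf,
      isObedient_simpleBelief prior f hT hTne hu hf hp, outcomeLaw_simpleBelief prior f⟩,
    fun f hf => hf.pooledObedience_iff hT, ?_,
    fun P _ ℱ μ τ h ho => h.solvesP_iff hT hTne hu hV ho, fun f _ hf => ?_⟩
  · obtain ⟨r, hr⟩ := exists_isLUB_valuesR (u := u) hT hTne hv prior
    exact ⟨r, by rwa [valuesP_eq_valuesR hT hTne hu hV], hr⟩
  · have h := isFeasible_simpleBelief prior f hf
    constructor
    · intro hs
      have ho := isObedient_simpleBelief prior f hT hTne hu hf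
        ((hf.pooledObedience_iff hT).2 hs.2.1)
      rw [← outcomeLaw_simpleBelief prior f] at hs
      exact (h.solvesP_iff hT hTne hu hV ho).2 hs
    · intro hs
      have hs' := (h.solvesP_iff hT hTne hu hV hs.2.1).1 hs
      rwa [outcomeLaw_simpleBelief] at hs'
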